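/- Let $X$ and $S$ be real analytic manifolds (finite-dimensional, Hausdorff, with countable basis). **Sites.** (1) $X_{sa}$: the objects are the subanalytic open subsets of $X$; a family $\{U_i\}$ of subanalytic open subsets of $U$ covers $U$ if for every compact $K\subset X$ there is a finite subfamily whose union $U_0$ satisfies $K\cap U_0=K\cap U$. (2) $X_{sa}\times S_{sa}$: the objects are the open subsets of $X\times S$ that are locally finite unions of products $U\times V$ with $U\subset X$, $V\subset S$ relatively compact subanalytic open; a family $T$ of objects contained in $W$ covers $W$ if for every such product $U\times V\subset W$ finitely many members of $T$ cover $U\times V$. (3) $X_{sa}\times S$: the objects are the finite unions of products $U\times V$ with $U\subset X$ subanalytic open and $V\subset S$ open. The topology is the Grothendieck topology generated by the following families: $T$ covers $W$ if for every product $U\times V\subset W$ of this kind there are a covering $\{U_i\}$ of $U$ in $X_{sa}$ and an open covering $\{V_j\}$ of $V$ such that each $U_i\times V_j$ is contained in a member of $T$. Sheaves are sheaves of complex vector spaces. **Inverse image.** For a sheaf $F$ on $X_{sa}\times S_{sa}$, let $a^{-1}F$ be its inverse image under the natural morphism of sites $a: X_{sa}\times S\to X_{sa}\times S_{sa}$,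 that is, the sheaf on $X_{sa}\times S$ associated with the presheaf $W\mapsto \varinjlim_{W'\supset W}\Gamma(W';F)$, where $W'$ runs through the objects of $X_{sa}\times S_{sa}$ containing $W$. **$\mathcal T$-flabby.** Let $\mathcal T$ be the family of finite unions of products $U\times V$ with $U\subset X$, $V\subset S$ relatively compact subanalytic open. The sheaf $F$ is $\mathcal T$-flabby if $\Gamma(X\times S;F)\to\Gamma(W;F)$ is surjective for every $W\in\mathcal T$. **c-soft.** For objects $V\subset U$ of $X_{sa}\times S$, say that $V$ is weakly quasi-compact in $U$, written $V\overset{wc}{\to}U$, if for every covering of $U$ the induced covering of $V$ has a finite refinement which is a covering of $V$. A sheaf $G$ on $X_{sa}\times S$ is c-soft if, for all objects $V,W,Y$ with $V\overset{wc}{\to}Y$, $W\overset{wc}{\to}Y$ and $V\overset{wc}{\to}W$, the natural map $\Gamma(W;G)\to\varinjlim_{V\overset{wc}{\to}U}\Gamma(U;G)$ is surjective. **Proposition.** If $F$ is a $\mathcal T$-flabby sheaf on $X_{sa}\times S_{sa}$, then $a^{-1}F$ is c-soft on $X_{sa}\times S$. -/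

import Mathlib

open CategoryTheory CategoryTheory.Limits TopologicalSpace Opposite
open scoped Manifold ContDiff Topology

universe u

/-! ### Subanalytic subsets of a real analytic manifold -/

/-- `A` is semianalytic: near every point of the manifold it belongs to the Boolean algebra
generated by the sets `{f > 0}` with `f` real analytic, i.e. it is described by a condition on
the signs of finitely many real analytic functions. -/
def IsSemianalytic {E H M : Type*} [NormedAddCommGroup E] [NormedSpace ℝ E] [TopologicalSpace H]
    [TopologicalSpace M] [ChartedSpace H M] (I : ModelWithCorners ℝ E H) (A : Set M) : Prop :=
  ∀ x : M, ∃ N : Set M, IsOpen N ∧ x ∈ N ∧ ∃ (k : ℕ) (f : Fin k → M → ℝ),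
    (∀ i, ContMDiffOn I 𝓘(ℝ, ℝ) ω (f i) N) ∧ ∃ C : Set (Fin k → SignType),
      ∀ y ∈ N, y ∈ A ↔ (fun i => SignType.sign (f i y)) ∈ C

/-- `A ⊆ M` is subanalytic: every point of `M` has an open neighbourhood `N` such that `A ∩ N` is
the projection to `M` of a relatively compact semianalytic subset of some `M × ℝᵐ`. -/
def IsSubanalytic (n : ℕ) {M : Type*} [TopologicalSpace M]
    [ChartedSpace (EuclideanSpace ℝ (Fin n)) M] (A : Set M) : Prop :=
  ∀ x : M, ∃ N : Set M, IsOpen N ∧ x ∈ N ∧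
    ∃ (m : ℕ) (B : Set (M × EuclideanSpace ℝ (Fin m))),
      IsSemianalytic ((𝓡 n).prod (𝓡 m)) B ∧ IsCompact (closure B) ∧ A ∩ N = Prod.fst '' B

/-- `𝒰` is a covering of the subanalytic open set `U` in the subanalytic site. -/
def IsSaCovering (n : ℕ) {M : Type*} [TopologicalSpace M]
    [ChartedSpace (EuclideanSpace ℝ (Fin n)) M] (𝒰 : Set (Opens M)) (U : Opens M) : Prop :=
  (∀ U' ∈ 𝒰, IsSubanalytic n (U' : Set M) ∧ U' ≤ U) ∧
    ∀ K : Set M, IsCompact K → ∃ 𝒰₀ ⊆ 𝒰, 𝒰₀.Finite ∧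
      K ∩ (sSup 𝒰₀ : Opens M) = K ∩ (U : Set M)

/-- Coordinate balls: every neighbourhood of a point contains a relatively compact subanalytic
open neighbourhood. -/
theorem exists_subanalytic_nhd (n : ℕ) {M : Type*} [TopologicalSpace M] [T2Space M]
    [ChartedSpace (EuclideanSpace ℝ (Fin n)) M] [IsManifold (𝓡 n) ω M] (x : M) {O : Set M}
    (hO : O ∈ 𝓝 x) : ∃ U : Opens M, x ∈ U ∧ (U : Set M) ⊆ O ∧ IsSubanalytic n (U : Set M) ∧
      IsCompact (closure (U : Set M)) := by
  set e := chartAt (EuclideanSpace ℝ (Fin n)) x with he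
  have hx : x ∈ e.source := mem_chart_source _ x
  have h1 : e.target ∩ e.symm ⁻¹' O ∈ 𝓝 (e x) := by
    refine Filter.inter_mem (e.open_target.mem_nhds (e.map_source hx)) ?_
    refine (e.continuousAt_symm (e.map_source hx)).preimage_mem_nhds ?_
    rwa [e.left_inv hx]
  obtain ⟨r, hr, hball⟩ := Metric.nhds_basis_closedBall.mem_iff.1 h1
  have hUo : IsOpen (e.source ∩ e ⁻¹' Metric.ball (e x) r) :=
    e.isOpen_inter_preimage Metric.isOpen_ball
  set K : Set M := e.symm '' Metric.closedBall (e x) r with hK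
  have hKc : IsCompact K :=
    (isCompact_closedBall _ _).image_of_continuousOn
      (e.continuousOn_symm.mono fun y hy => (hball hy).1)
  have hUK : e.source ∩ e ⁻¹' Metric.ball (e x) r ⊆ K := fun y hy =>
    ⟨e y, Metric.ball_subset_closedBall hy.2, e.left_inv hy.1⟩
  have hKs : K ⊆ e.source := by
    rintro _ ⟨z, hz, rfl⟩
    exact e.map_target (hball hz).1
  refine ⟨⟨_, hUo⟩, ⟨hx, Metric.mem_ball_self hr⟩, ?_, ?_,
    hKc.of_isClosed_subset isClosed_closure (closure_minimal hUK hKc.isClosed)⟩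
  · intro y hy
    have := (hball (Metric.ball_subset_closedBall hy.2)).2
    rwa [Set.mem_preimage, e.left_inv hy.1] at this
  · intro y
    refine ⟨Set.univ, isOpen_univ, trivial, 0,
      Prod.fst ⁻¹' (e.source ∩ e ⁻¹' Metric.ball (e x) r), ?_, ?_, ?_⟩
    · rintro ⟨y, z⟩
      by_cases hy : y ∈ e.source
      · refine ⟨Prod.fst ⁻¹' e.source, e.open_source.preimage continuous_fst, hy, 1,
          fun _ p => r ^ 2 - ‖e p.1 - e x‖ ^ 2, fun _ => ?_, {s | s 0 = 1}, ?_⟩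
        · have h2 : ContMDiffOn ((𝓡 n).prod (𝓡 0)) (𝓡 n) ω
              (fun p : M × EuclideanSpace ℝ (Fin 0) => e p.1) (Prod.fst ⁻¹' e.source) :=
            (contMDiffOn_chart (I := 𝓡 n) (n := ω) (x := x)).comp
              contMDiff_fst.contMDiffOn (fun p hp => hp)
          have h3 : ContDiff ℝ ω (fun v : EuclideanSpace ℝ (Fin n) => r ^ 2 - ‖v - e x‖ ^ 2) :=
            contDiff_const.sub ((contDiff_id.sub contDiff_const).norm_sq ℝ)
          exact h3.contMDiff.comp_contMDiffOn h2
        · rintro ⟨p, q⟩ hp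
          have hp' : p ∈ e.source := hp
          simp only [Set.mem_preimage, Set.mem_inter_iff, hp', true_and, Metric.mem_ball,
            dist_eq_norm, Set.mem_ofPred_eq, sign_eq_one_iff, sub_pos]
          exact (sq_lt_sq₀ (norm_nonneg _) hr.le).symm
      · refine ⟨Prod.fst ⁻¹' Kᶜ, hKc.isClosed.isOpen_compl.preimage continuous_fst,
          fun h => hy (hKs h), 0, fun i => i.elim0, fun i => i.elim0, ∅, ?_⟩
        rintro ⟨p, q⟩ hp
        simp only [Set.mem_empty_iff_false, iff_false]
        exact fun h => hp (hUK h)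
    · refine (hKc.prod isCompact_univ).of_isClosed_subset isClosed_closure
        (closure_minimal (t := K ×ˢ (Set.univ : Set (EuclideanSpace ℝ (Fin 0))))
          (fun p hp => ⟨hUK hp, trivial⟩) (hKc.isClosed.prod isClosed_univ))
    · rw [Set.inter_univ, Set.image_preimage_eq _ Prod.fst_surjective]
      rfl

/-- The product `U × V` as an open subset of `X × S`. -/
def openBox {X S : Type*} [TopologicalSpace X] [TopologicalSpace S] (U : Opens X) (V : Opens S) :
    Opens (X × S) :=
  ⟨(U : Set X) ×ˢ (V : Set S), U.isOpen.prod V.isOpen⟩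

/-! ### Sites given by a partially ordered family of objects -/

/-- The Grothendieck topology on a preorder generated by a class of covering families: `cov W` is
the set of families `T` such that the members `≤ W` of `T` cover `W`. -/
def generatedTopology {C : Type*} [Preorder C] (cov : C → Set (Set C)) : GrothendieckTopology C :=
  Precoverage.toGrothendieck
    { coverings := fun W => {R | {W' | ∃ f : W' ⟶ W, R f} ∈ cov W} }

/-- `V` is weakly quasi-compact in `U`: for every covering of `U`, the induced covering of `V`
admits a finite refinement which is a covering of `V`. -/
def IsWeaklyQuasiCompactIn {C : Type*} [Preorder C] (J : GrothendieckTopology C) (V U : C) :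
    Prop :=
  ∃ h : V ≤ U, ∀ R ∈ J U, ∃ T : Set C, T.Finite ∧
    (∀ W ∈ T, ∃ hW : W ≤ V, R (homOfLE (hW.trans h))) ∧
    Sieve.generate (X := V) (fun W _ => W ∈ T) ∈ J V

/-- The poset of the objects `U` in which `V` is weakly quasi-compact. -/
abbrev WeaklyQuasiCompactNhd {C : Type u} [Preorder C] (J : GrothendieckTopology C) (V : C) :
    Type u :=
  {U : C // IsWeaklyQuasiCompactIn J V U}

/-- The inductive system `U ↦ Γ(U; F)`, where `U` runs through the objects in which `V` is weakly
quasi-compact, ordered by reverse inclusion. -/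
def germSystem {C : Type u} [Preorder C] {J : GrothendieckTopology C}
    (F : Sheaf J (ModuleCat.{u} ℂ)) (V : C) :
    (WeaklyQuasiCompactNhd J V)ᵒᵖ ⥤ ModuleCat.{u} ℂ :=
  (Subtype.mono_coe (IsWeaklyQuasiCompactIn J V)).functor.op ⋙ F.obj

/-- `F` is c-soft: `Γ(W; F) → colim_U Γ(U; F)`, the colimit over the `U` in which `V` is weakly
quasi-compact, is surjective whenever `V`, `W` are weakly quasi-compact in some `Y` and `V` is
weakly quasi-compact in `W`. -/
def IsCSoft {C : Type u} [Preorder C] {J : GrothendieckTopology C}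
    (F : Sheaf J (ModuleCat.{u} ℂ)) : Prop :=
  ∀ (Y V W : C), IsWeaklyQuasiCompactIn J V Y → IsWeaklyQuasiCompactIn J W Y →
    ∀ hVW : IsWeaklyQuasiCompactIn J V W,
      Function.Surjective (colimit.ι (germSystem F V) (op ⟨W, hVW⟩)).hom

/-- Needed for the sheafification of presheaves of complex vector spaces in any universe. -/
instance preservesFilteredColimits_forget_moduleCat_complex :
    PreservesFilteredColimits (forget (ModuleCat.{u} ℂ)) :=
  Limits.comp_preservesFilteredColimits.{u, u} (forget₂ (ModuleCat.{u} ℂ) AddCommGrpCat.{u})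
    (forget AddCommGrpCat.{u})

section ProductSites

variable (n d : ℕ) (X S : Type u) [TopologicalSpace X] [TopologicalSpace S]
  [ChartedSpace (EuclideanSpace ℝ (Fin n)) X] [ChartedSpace (EuclideanSpace ℝ (Fin d)) S]

variable {X S} in
/-- `P = U × V` with `U`, `V` relatively compact subanalytic open subsets of `X` and `S`. -/
def IsSaBox (P : Opens (X × S)) : Prop :=
  ∃ (U : Opens X) (V : Opens S), IsSubanalytic n (U : Set X) ∧ IsCompact (closure (U : Set X)) ∧
    IsSubanalytic d (V : Set S) ∧ IsCompact (closure (V : Set S)) ∧ P = openBox U V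

variable {X S} in
/-- The family `𝒯`: finite unions of products `U × V` with `U`, `V` relatively compact
subanalytic open subsets of `X` and `S`. -/
def IsFiniteUnionOfSaBoxes (W : Opens (X × S)) : Prop :=
  ∃ 𝓑 : Set (Opens (X × S)), 𝓑.Finite ∧ (∀ P ∈ 𝓑, IsSaBox n d P) ∧ W = sSup 𝓑

/-- `op(X_sa × S_sa)`: locally finite unions of products of relatively compact subanalytic open
subsets. -/
abbrev OpSaSa : Type u :=
  {W : Opens (X × S) // ∃ 𝓑 : Set (Opens (X × S)), (∀ P ∈ 𝓑, IsSaBox n d P) ∧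
    LocallyFinite (fun P : 𝓑 => ((P : Opens (X × S)) : Set (X × S))) ∧ W = sSup 𝓑}

/-- The coverings of the site `X_sa × S_sa`: a family covers `W` if its trace on each product
`U × V ⊆ W` of relatively compact subanalytic open sets admits a finite subcover. -/
def saSaCoverings (W : OpSaSa n d X S) : Set (Set (OpSaSa n d X S)) :=
  {T | ∀ P : Opens (X × S), IsSaBox n d P → P ≤ W.1 →
    ∃ T₀ ⊆ T, T₀.Finite ∧ (P : Set (X × S)) ⊆ ⋃ W' ∈ T₀, ((W' : Opens (X × S)) : Set (X × S))}

/-- The site `X_sa × S_sa`. -/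
abbrev saSaTopology : GrothendieckTopology (OpSaSa n d X S) :=
  generatedTopology (saSaCoverings n d X S)

/-- `X × S` is a locally finite union of products of relatively compact subanalytic open sets. -/
theorem exists_locallyFinite_saBoxes [T2Space X] [SecondCountableTopology X]
    [IsManifold (𝓡 n) ω X] [T2Space S] [SecondCountableTopology S] [IsManifold (𝓡 d) ω S] :
    ∃ 𝓑 : Set (Opens (X × S)), (∀ P ∈ 𝓑, IsSaBox n d P) ∧
      LocallyFinite (fun P : 𝓑 => ((P : Opens (X × S)) : Set (X × S))) ∧ ⊤ = sSup 𝓑 := by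
  have : LocallyCompactSpace X := ChartedSpace.locallyCompactSpace (EuclideanSpace ℝ (Fin n)) X
  have : LocallyCompactSpace S := ChartedSpace.locallyCompactSpace (EuclideanSpace ℝ (Fin d)) S
  have hB : ∀ p : X × S, (𝓝 p).HasBasis (fun P : Opens (X × S) => p ∈ P ∧ IsSaBox n d P)
      (fun P => (P : Set (X × S))) := by
    refine fun p => ⟨fun O => ⟨fun hO => ?_, ?_⟩⟩
    · obtain ⟨O₁, h₁, O₂, h₂, h⟩ := mem_nhds_prod_iff.1 hO
      obtain ⟨U, hxU, hUO, hU, hUc⟩ := exists_subanalytic_nhd n p.1 h₁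
      obtain ⟨V, hxV, hVO, hV, hVc⟩ := exists_subanalytic_nhd d p.2 h₂
      exact ⟨openBox U V, ⟨⟨hxU, hxV⟩, U, V, hU, hUc, hV, hVc, rfl⟩,
        (Set.prod_mono hUO hVO).trans h⟩
    · rintro ⟨P, ⟨hp, -⟩, hPO⟩
      exact Filter.mem_of_superset (P.isOpen.mem_nhds hp) hPO
  obtain ⟨α, c, P, hP, hcov, hfin⟩ :=
    refinement_of_locallyCompact_sigmaCompact_of_nhds_basis.{u, u} hB
  refine ⟨Set.range P, ?_, ?_, ?_⟩
  · rintro _ ⟨a, rfl⟩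
    exact (hP a).2
  · refine hfin.on_range.comp_injective
      (g := fun Q : Set.range P => (⟨Q.1, Q.2.imp fun a h => congrArg _ h⟩ :
        Set.range fun a => (P a : Set (X × S)))) fun Q Q' h => ?_
    exact Subtype.ext (Opens.ext (Subtype.ext_iff.1 h))
  · refine (eq_top_iff.2 fun p _ => ?_).symm
    obtain ⟨a, ha⟩ := Set.mem_iUnion.1 (hcov.symm ▸ Set.mem_univ p : p ∈ ⋃ a, (P a : Set _))
    exact Opens.mem_sSup.2 ⟨P a, ⟨a, rfl⟩, ha⟩

/-- `X × S` as an object of `op(X_sa × S_sa)`. -/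
def saSaTop [T2Space X] [SecondCountableTopology X] [IsManifold (𝓡 n) ω X] [T2Space S]
    [SecondCountableTopology S] [IsManifold (𝓡 d) ω S] : OpSaSa n d X S :=
  ⟨⊤, exists_locallyFinite_saBoxes n d X S⟩

variable {n d X S} in
/-- `F` is `𝒯`-flabby: `Γ(X × S; F) → Γ(W; F)` is surjective for every `W ∈ 𝒯`. -/
def IsTFlabby [T2Space X] [SecondCountableTopology X] [IsManifold (𝓡 n) ω X] [T2Space S]
    [SecondCountableTopology S] [IsManifold (𝓡 d) ω S]
    (F : Sheaf (saSaTopology n d X S) (ModuleCat.{u} ℂ)) : Prop :=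
  ∀ W : OpSaSa n d X S, IsFiniteUnionOfSaBoxes n d W.1 →
    Function.Surjective
      (F.obj.map (homOfLE (le_top (a := W.1)) : W ⟶ saSaTop n d X S).op).hom

/-- `op(X_sa × S)`: finite unions of products `U × V` with `U ⊆ X` subanalytic open and `V ⊆ S`
open. -/
abbrev OpSa : Type u :=
  {W : Opens (X × S) // ∃ 𝓑 : Set (Opens (X × S)), 𝓑.Finite ∧
    (∀ P ∈ 𝓑, ∃ (U : Opens X) (V : Opens S), IsSubanalytic n (U : Set X) ∧ P = openBox U V) ∧
    W = sSup 𝓑}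

/-- The coverings generating the site `X_sa × S`: a family covers `W` if on each product
`U × V ⊆ W` (`U` subanalytic open, `V` open) it is refined by `{Uᵢ × Vⱼ}` for a covering `{Uᵢ}`
of `U` in `X_sa` and an open covering `{Vⱼ}` of `V`. -/
def saCoverings (W : OpSa n X S) : Set (Set (OpSa n X S)) :=
  {T | ∀ (U : Opens X) (V : Opens S), IsSubanalytic n (U : Set X) → openBox U V ≤ W.1 →
    ∃ (𝒰 : Set (Opens X)) (𝒱 : Set (Opens S)), IsSaCovering n 𝒰 U ∧ sSup 𝒱 = V ∧
      ∀ U' ∈ 𝒰, ∀ V' ∈ 𝒱, ∃ W' ∈ T, openBox U' V' ≤ W'.1}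

/-- The site `X_sa × S`. -/
abbrev saTopology : GrothendieckTopology (OpSa n X S) :=
  generatedTopology (saCoverings n X S)

/-- The inclusion of `op(X_sa × S_sa)` into the open subsets of `X × S`. -/
abbrev saSaInclusion : OpSaSa n d X S ⥤ Opens (X × S) :=
  Monotone.functor (f := fun W : OpSaSa n d X S => W.1) (Subtype.mono_coe _)

/-- The inclusion of `op(X_sa × S)` into the open subsets of `X × S`. -/
abbrev saInclusion : OpSa n X S ⥤ Opens (X × S) :=
  Monotone.functor (f := fun W : OpSa n X S => W.1) (Subtype.mono_coe _)

variable {n d X S} in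
/-- The presheaf `W ↦ colim_{W' ⊇ W} Γ(W'; F)` on `op(X_sa × S)`, the colimit being over the
`W' ∈ op(X_sa × S_sa)` containing `W`: the (pointwise) left Kan extension of `F` to all open
subsets of `X × S`, restricted to `op(X_sa × S)`. -/
noncomputable def inverseImagePresheaf (F : Sheaf (saSaTopology n d X S) (ModuleCat.{u} ℂ)) :
    (OpSa n X S)ᵒᵖ ⥤ ModuleCat.{u} ℂ :=
  (saInclusion n X S).op ⋙ (saSaInclusion n d X S).op.lan.obj F.obj

variable {n d X S} in
/-- The inverse image `a⁻¹F` on `X_sa × S` of a sheaf `F` on `X_sa × S_sa`, for the natural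
morphism of sites `a : X_sa × S → X_sa × S_sa`: the sheaf associated with the presheaf
`W ↦ colim_{W' ⊇ W} Γ(W'; F)`. -/
noncomputable def inverseImage (F : Sheaf (saSaTopology n d X S) (ModuleCat.{u} ℂ)) :
    Sheaf (saTopology n X S) (ModuleCat.{u} ℂ) :=
  (presheafToSheaf (saTopology n X S) (ModuleCat.{u} ℂ)).obj (inverseImagePresheaf F)

end ProductSites

/-!
In `X_sa × S`, an object `V` is weakly quasi-compact in `O` if and only if it is a finite union of
boxes `A × B` with `A` relatively compact subanalytic and `B` relatively compact in some `D` such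
that `A × D ⊆ O`; write `V ⋐ O`. Between `V ⋐ O` one can interpose a member of `𝒯`, by enlarging the
sides `B` only. Every `O` is covered by the objects `⋐ O`, and a covering of `O` induces a finite
covering of each `V ⋐ O`, so that `Γ(O; a⁻¹F)` is the limit of `Γ(P; F)` over `P ⋐ O`. A section of
`a⁻¹F` over `U`, where `V ⋐ U` and `V ⋐ W`, thus gives an element of `Γ(P; F)` for some `P ∈ 𝒯` with
`V ⋐ P ⋐ U ∩ W`. As `F` is `𝒯`-flabby, this element extends to `X × S`, and the extension restricts
to a section of `a⁻¹F` over `W`.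
-/

/-! ### Subanalytic sets -/

section Subanalytic

variable {E H M E' H' M' : Type*} [NormedAddCommGroup E] [NormedSpace ℝ E] [TopologicalSpace H]
  [TopologicalSpace M] [ChartedSpace H M] [NormedAddCommGroup E'] [NormedSpace ℝ E']
  [TopologicalSpace H'] [TopologicalSpace M'] [ChartedSpace H' M']
  {I : ModelWithCorners ℝ E H} {I' : ModelWithCorners ℝ E' H'}

theorem IsSemianalytic.preimage {A : Set M} (hA : IsSemianalytic I A) {φ : M' → M}
    (hφ : ContMDiff I' I ω φ) : IsSemianalytic I' (φ ⁻¹' A) := by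
  intro x
  obtain ⟨N, hN, hx, k, f, hf, C, hC⟩ := hA (φ x)
  exact ⟨φ ⁻¹' N, hN.preimage hφ.continuous, hx, k, fun i => f i ∘ φ,
    fun i => (hf i).comp hφ.contMDiffOn fun y hy => hy, C, fun y hy => hC (φ y) hy⟩

theorem IsSemianalytic.inter {A B : Set M} (hA : IsSemianalytic I A) (hB : IsSemianalytic I B) :
    IsSemianalytic I (A ∩ B) := by
  intro x
  obtain ⟨N, hN, hx, k, f, hf, C, hC⟩ := hA x
  obtain ⟨N', hN', hx', k', f', hf', C', hC'⟩ := hB x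
  refine ⟨N ∩ N', hN.inter hN', ⟨hx, hx'⟩, k + k', Fin.append f f', fun i => ?_,
    {s | (fun i => s (Fin.castAdd k' i)) ∈ C ∧ (fun i => s (Fin.natAdd k i)) ∈ C'},
    fun y hy => ?_⟩
  · refine Fin.addCases (fun i => ?_) (fun i => ?_) i
    · simpa using (hf i).mono Set.inter_subset_left
    · simpa using (hf' i).mono Set.inter_subset_right
  · simp [hC y hy.1, hC' y hy.2]

/-- The witness is the fibre product of `B` and `B'` over `M`. -/
theorem exists_isSemianalytic_image_fst_eq_inter {n m m' : ℕ} [T2Space M]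
    [ChartedSpace (EuclideanSpace ℝ (Fin n)) M] {B : Set (M × EuclideanSpace ℝ (Fin m))}
    {B' : Set (M × EuclideanSpace ℝ (Fin m'))} (hB : IsSemianalytic ((𝓡 n).prod (𝓡 m)) B)
    (hBc : IsCompact (closure B)) (hB' : IsSemianalytic ((𝓡 n).prod (𝓡 m')) B')
    (hBc' : IsCompact (closure B')) :
    ∃ (k : ℕ) (C : Set (M × EuclideanSpace ℝ (Fin k))), IsSemianalytic ((𝓡 n).prod (𝓡 k)) C ∧
      IsCompact (closure C) ∧ Prod.fst '' C = Prod.fst '' B ∩ Prod.fst '' B' := by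
  let l : (EuclideanSpace ℝ (Fin m) × EuclideanSpace ℝ (Fin m')) ≃L[ℝ]
      EuclideanSpace ℝ (Fin (m + m')) := ContinuousLinearEquiv.ofFinrankEq (by simp)
  let φ : M × EuclideanSpace ℝ (Fin (m + m')) → M × EuclideanSpace ℝ (Fin m) :=
    fun p => (p.1, (l.symm p.2).1)
  let φ' : M × EuclideanSpace ℝ (Fin (m + m')) → M × EuclideanSpace ℝ (Fin m') :=
    fun p => (p.1, (l.symm p.2).2)
  have hφ : ContMDiff ((𝓡 n).prod (𝓡 (m + m'))) ((𝓡 n).prod (𝓡 m)) ω φ :=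
    contMDiff_fst.prodMk ((contDiff_fst.comp l.symm.contDiff).contMDiff.comp contMDiff_snd)
  have hφ' : ContMDiff ((𝓡 n).prod (𝓡 (m + m'))) ((𝓡 n).prod (𝓡 m')) ω φ' :=
    contMDiff_fst.prodMk ((contDiff_snd.comp l.symm.contDiff).contMDiff.comp contMDiff_snd)
  refine ⟨m + m', φ ⁻¹' B ∩ φ' ⁻¹' B', (hB.preimage hφ).inter (hB'.preimage hφ'), ?_, ?_⟩
  · have hK : IsCompact ((fun q : (M × EuclideanSpace ℝ (Fin m)) × M × EuclideanSpace ℝ (Fin m') =>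
        (q.1.1, l (q.1.2, q.2.2))) '' closure B ×ˢ closure B') :=
      (hBc.prod hBc').image (by fun_prop)
    refine hK.closure_of_subset ?_
    rintro p ⟨hp, hp'⟩
    exact ⟨(φ p, φ' p), ⟨subset_closure hp, subset_closure hp'⟩, by simp [φ, φ']⟩
  · refine Set.Subset.antisymm ?_ ?_
    · rintro _ ⟨p, ⟨hp, hp'⟩, rfl⟩
      exact ⟨⟨φ p, hp, rfl⟩, ⟨φ' p, hp', rfl⟩⟩
    · rintro _ ⟨⟨⟨_, v⟩, hv, rfl⟩, ⟨⟨y, v'⟩, hv', rfl⟩⟩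
      exact ⟨(y, l (v, v')), ⟨by simpa [φ] using hv, by simpa [φ'] using hv'⟩, rfl⟩

theorem IsSubanalytic.inter {n : ℕ} [T2Space M] [ChartedSpace (EuclideanSpace ℝ (Fin n)) M]
    {A A' : Set M} (hA : IsSubanalytic n A) (hA' : IsSubanalytic n A') :
    IsSubanalytic n (A ∩ A') := by
  intro x
  obtain ⟨N, hN, hx, m, B, hB, hBc, hAB⟩ := hA x
  obtain ⟨N', hN', hx', m', B', hB', hBc', hAB'⟩ := hA' x
  obtain ⟨k, C, hC, hCc, hCB⟩ := exists_isSemianalytic_image_fst_eq_inter hB hBc hB' hBc'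
  exact ⟨N ∩ N', hN.inter hN', ⟨hx, hx'⟩, k, C, hC, hCc, by
    rw [hCB, ← hAB, ← hAB', Set.inter_inter_inter_comm]⟩

theorem IsSubanalytic.inf_finsetInf {n : ℕ} [T2Space M]
    [ChartedSpace (EuclideanSpace ℝ (Fin n)) M] {U : Opens M} (hU : IsSubanalytic n (U : Set M))
    {𝓐 : Finset (Opens M)} (h𝓐 : ∀ A ∈ 𝓐, IsSubanalytic n (A : Set M)) :
    IsSubanalytic n ((U ⊓ 𝓐.inf id : Opens M) : Set M) := by
  refine Finset.inf_induction (p := fun V : Opens M => IsSubanalytic n ((U ⊓ V : Opens M) : Set M))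
    (by simpa using hU) (fun V hV V' hV' => ?_) fun A hA => hU.inter (h𝓐 A hA)
  rw [inf_inf_distrib_left]
  exact hV.inter hV'

end Subanalytic

/-! ### Finite suprema -/

/-- `V` is the supremum of a finite family of elements satisfying `p`. With `L` the lattice of open
subsets of `X × S`, this is the shape of the definitions of `𝒯` and of `op(X_sa × S)`. -/
def IsFiniteSup {L : Type*} [CompleteLattice L] (p : L → Prop) (V : L) : Prop :=
  ∃ 𝓑 : Set L, 𝓑.Finite ∧ (∀ P ∈ 𝓑, p P) ∧ V = sSup 𝓑

namespace IsFiniteSup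

section CompleteLattice

variable {L : Type*} [CompleteLattice L] {p q : L → Prop} {V W : L}

theorem of (h : p V) : IsFiniteSup p V :=
  ⟨{V}, Set.finite_singleton V, by simpa using h, sSup_singleton.symm⟩

protected theorem bot : IsFiniteSup p ⊥ :=
  ⟨∅, Set.finite_empty, by simp, sSup_empty.symm⟩

protected theorem sup (hV : IsFiniteSup p V) (hW : IsFiniteSup p W) : IsFiniteSup p (V ⊔ W) := by
  obtain ⟨𝓑, hfin, h, rfl⟩ := hV
  obtain ⟨𝓒, hfin', h', rfl⟩ := hW
  exact ⟨𝓑 ∪ 𝓒, hfin.union hfin', fun P => Or.rec (h P) (h' P), sSup_union.symm⟩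

@[elab_as_elim]
protected theorem induction {motive : L → Prop} (hV : IsFiniteSup p V) (bot : motive ⊥)
    (sup : ∀ P Q, motive P → motive Q → motive (P ⊔ Q)) (of : ∀ P, p P → motive P) :
    motive V := by
  obtain ⟨𝓑, hfin, h, rfl⟩ := hV
  induction 𝓑, hfin using Set.Finite.induction_on with
  | empty => simpa using bot
  | @insert P 𝓑 _ _ ih =>
    rw [sSup_insert]
    exact sup _ _ (of P (h P (Set.mem_insert P 𝓑)))
      (ih fun Q hQ => h Q (Set.mem_insert_of_mem P hQ))

theorem bind (hV : IsFiniteSup p V) (h : ∀ P ≤ V, p P → IsFiniteSup q P) : IsFiniteSup q V := by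
  have hle : V ≤ V → IsFiniteSup q V := hV.induction (motive := fun P => P ≤ V → IsFiniteSup q P)
    (fun _ => .bot)
    (fun P Q hP hQ hPQ => (hP (le_sup_left.trans hPQ)).sup (hQ (le_sup_right.trans hPQ)))
    fun P hP hPV => h P hPV hP
  exact hle le_rfl

theorem mono (hV : IsFiniteSup p V) (h : ∀ P ≤ V, p P → q P) : IsFiniteSup q V :=
  hV.bind fun P hPV hP => .of (h P hPV hP)

end CompleteLattice

section Frame

variable {L : Type*} [Order.Frame L] {p q r : L → Prop} {V W : L}

theorem inf_of (hV : IsFiniteSup p V) (h : ∀ P, p P → IsFiniteSup q (P ⊓ W)) :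
    IsFiniteSup q (V ⊓ W) := by
  refine hV.induction (by simpa using IsFiniteSup.bot) (fun P Q hP hQ => ?_) h
  rw [inf_sup_right]
  exact hP.sup hQ

theorem inf (h : ∀ P Q, p P → q Q → r (P ⊓ Q)) (hV : IsFiniteSup p V) (hW : IsFiniteSup q W) :
    IsFiniteSup r (V ⊓ W) :=
  hV.inf_of fun P hP => inf_comm P W ▸ hW.inf_of fun Q hQ => .of (inf_comm P Q ▸ h P Q hP hQ)

theorem of_le (hV : IsFiniteSup p V) (hWV : W ≤ V) (h : ∀ P, p P → q (P ⊓ W)) :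
    IsFiniteSup q W :=
  inf_eq_right.2 hWV ▸ hV.inf_of fun P hP => .of (h P hP)

end Frame

end IsFiniteSup

theorem exists_isFiniteSup_of_isCompact {M : Type*} [TopologicalSpace M] {p : Opens M → Prop}
    {K : Set M} (hK : IsCompact K) (h : ∀ x ∈ K, ∃ U : Opens M, x ∈ U ∧ p U) :
    ∃ V : Opens M, K ⊆ V ∧ IsFiniteSup p V := by
  choose! U hxU hpU using h
  obtain ⟨t, ht, hKt⟩ := hK.elim_nhds_subcover (fun x => (U x : Set M))
    fun x hx => (U x).isOpen.mem_nhds (hxU x hx)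
  refine ⟨sSup (U '' t), fun x hx => ?_, U '' t, t.finite_toSet.image U, ?_, rfl⟩
  · obtain ⟨y, hy, hxy⟩ := Set.mem_iUnion₂.1 (hKt hx)
    exact Opens.mem_sSup.2 ⟨U y, ⟨y, hy, rfl⟩, hxy⟩
  · rintro _ ⟨y, hy, rfl⟩
    exact hpU y (ht y hy)

/-! ### Relatively compact inclusions -/

section CompactlyContained

variable {M : Type*} [TopologicalSpace M] {U U' V V' : Opens M}

theorem isCompact_closure_of_le (hV : IsCompact (closure (V : Set M))) (hUV : U ≤ V) :
    IsCompact (closure (U : Set M)) :=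
  hV.of_isClosed_subset isClosed_closure (closure_mono hUV)

/-- `U` is relatively compact in `V`. -/
def CompactlyContained (U V : Opens M) : Prop :=
  IsCompact (closure (U : Set M)) ∧ closure (U : Set M) ⊆ V

theorem CompactlyContained.le (h : CompactlyContained U V) : U ≤ V :=
  subset_closure.trans h.2

theorem CompactlyContained.mono_left (h : CompactlyContained U V) (hU : U' ≤ U) :
    CompactlyContained U' V :=
  ⟨isCompact_closure_of_le h.1 hU, (closure_mono hU).trans h.2⟩

theorem CompactlyContained.inf (h : CompactlyContained U V) (h' : CompactlyContained U' V') :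
    CompactlyContained (U ⊓ U') (V ⊓ V') :=
  ⟨(h.mono_left inf_le_left).1,
    Set.subset_inter (h.mono_left inf_le_left).2 (h'.mono_left inf_le_right).2⟩

theorem exists_mem_compactlyContained [LocallyCompactSpace M] [T2Space M] {x : M} (hx : x ∈ V) :
    ∃ U : Opens M, x ∈ U ∧ CompactlyContained U V := by
  obtain ⟨O, hO, hxO, hOV, hOc⟩ := exists_open_between_and_isCompact_closure
    isCompact_singleton V.isOpen (Set.singleton_subset_iff.2 hx)
  exact ⟨⟨O, hO⟩, hxO rfl, hOc, hOV⟩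

theorem exists_mem_isSubanalytic_compactlyContained {n : ℕ} [T2Space M]
    [ChartedSpace (EuclideanSpace ℝ (Fin n)) M] [IsManifold (𝓡 n) ω M] {x : M} (hx : x ∈ V) :
    ∃ U : Opens M, x ∈ U ∧ IsSubanalytic n (U : Set M) ∧ CompactlyContained U V := by
  have : LocallyCompactSpace M := ChartedSpace.locallyCompactSpace (EuclideanSpace ℝ (Fin n)) M
  obtain ⟨O, hxO, hOV⟩ := exists_mem_compactlyContained hx
  obtain ⟨U, hxU, hUO, hU, -⟩ := exists_subanalytic_nhd n x (O.isOpen.mem_nhds hxO)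
  exact ⟨U, hxU, hU, hOV.mono_left hUO⟩

theorem sSup_setOf_compactlyContained [LocallyCompactSpace M] [T2Space M] (V : Opens M) :
    sSup {B | CompactlyContained B V} = V :=
  le_antisymm (sSup_le fun _ hB => hB.le) fun _ hx =>
    let ⟨B, hxB, hB⟩ := exists_mem_compactlyContained hx
    Opens.mem_sSup.2 ⟨B, hB, hxB⟩

end CompactlyContained

section SubanalyticSite

variable {n : ℕ} {M : Type*} [TopologicalSpace M] [ChartedSpace (EuclideanSpace ℝ (Fin n)) M]
  {U : Opens M}

theorem IsSaCovering.isFiniteSup {𝒰 : Set (Opens M)} (h : IsSaCovering n 𝒰 U)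
    (hU : IsCompact (closure (U : Set M))) : IsFiniteSup (· ∈ 𝒰) U := by
  obtain ⟨𝒰₀, h𝒰₀, hfin, hcov⟩ := h.2 _ hU
  refine ⟨𝒰₀, hfin, h𝒰₀, le_antisymm (fun x hx => ?_) (sSup_le fun V hV => (h.1 V (h𝒰₀ hV)).2)⟩
  exact (hcov.ge ⟨subset_closure hx, hx⟩).2

theorem isSaCovering_setOf_isCompact_closure [T2Space M] [IsManifold (𝓡 n) ω M]
    (hU : IsSubanalytic n (U : Set M)) :
    IsSaCovering n {A : Opens M | (IsSubanalytic n (A : Set M) ∧ A ≤ U) ∧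
      IsCompact (closure (A : Set M))} U := by
  refine ⟨fun A hA => hA.1, fun K hK => ?_⟩
  obtain ⟨_, hKV, 𝓔, hfin, h𝓔, rfl⟩ := exists_isFiniteSup_of_isCompact hK fun x _ =>
    exists_mem_isSubanalytic_compactlyContained (n := n) (V := ⊤) (Opens.mem_top x)
  refine ⟨(U ⊓ ·) '' 𝓔, ?_, hfin.image _, ?_⟩
  · rintro _ ⟨E, hE, rfl⟩
    exact ⟨⟨hU.inter (h𝓔 E hE).1, inf_le_left⟩,
      isCompact_closure_of_le (h𝓔 E hE).2.1 inf_le_right⟩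
  · rw [sSup_image, ← inf_sSup_eq, Opens.coe_inf, Set.inter_left_comm,
      Set.inter_eq_left.2 hKV, Set.inter_comm]

end SubanalyticSite

section Cell

variable {M : Type*} [TopologicalSpace M]

open Classical in
/-- The intersection of the members of the finite family `𝓐` that contain `x`. The cells of the
sides of finitely many boxes give a product covering that refines these boxes. -/
noncomputable def cell (𝓐 : Finset (Opens M)) (x : M) : Opens M :=
  {A ∈ 𝓐 | x ∈ A}.inf id

open Classical in
theorem mem_cell (𝓐 : Finset (Opens M)) (x : M) : x ∈ cell 𝓐 x :=
  Finset.inf_induction (p := (x ∈ ·)) (Opens.mem_top x) (fun _ h _ h' => ⟨h, h'⟩)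
    fun _ hA => (Finset.mem_filter.1 hA).2

open Classical in
theorem cell_le {𝓐 : Finset (Opens M)} {A : Opens M} (hA : A ∈ 𝓐) {x : M} (hx : x ∈ A) :
    cell 𝓐 x ≤ A :=
  Finset.inf_le (f := id) (Finset.mem_filter.2 ⟨hA, hx⟩)

theorem finite_range_cell (𝓐 : Finset (Opens M)) : (Set.range (cell 𝓐)).Finite := by
  classical
  refine (𝓐.powerset.image fun 𝓑 => 𝓑.inf id).finite_toSet.subset ?_
  rintro _ ⟨x, rfl⟩
  exact Finset.mem_coe.2 (Finset.mem_image_of_mem _ (Finset.mem_powerset.2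
    (Finset.filter_subset _ _)))

theorem sSup_image_inf_cell (𝓐 : Finset (Opens M)) (U : Opens M) :
    sSup ((fun x => U ⊓ cell 𝓐 x) '' U) = U := by
  refine le_antisymm (sSup_le ?_) fun x hx =>
    Opens.mem_sSup.2 ⟨_, ⟨x, hx, rfl⟩, hx, mem_cell 𝓐 x⟩
  rintro _ ⟨x, -, rfl⟩
  exact inf_le_left

open Classical in
theorem isSaCovering_image_inf_cell {n : ℕ} [T2Space M]
    [ChartedSpace (EuclideanSpace ℝ (Fin n)) M] {U : Opens M} (hU : IsSubanalytic n (U : Set M))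
    {𝓐 : Finset (Opens M)} (h𝓐 : ∀ A ∈ 𝓐, IsSubanalytic n (A : Set M)) :
    IsSaCovering n ((fun x => U ⊓ cell 𝓐 x) '' U) U := by
  refine ⟨?_, fun K _ => ⟨_, subset_rfl, ?_, by rw [sSup_image_inf_cell]⟩⟩
  · rintro _ ⟨x, -, rfl⟩
    exact ⟨hU.inf_finsetInf fun A hA => h𝓐 A (Finset.filter_subset _ _ hA), inf_le_left⟩
  · refine ((finite_range_cell 𝓐).image (U ⊓ ·)).subset ?_
    rintro _ ⟨x, -, rfl⟩
    exact ⟨_, ⟨x, rfl⟩, rfl⟩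

end Cell

/-! ### The site `X_sa × S` -/

section Boxes

variable {n d : ℕ} {X S : Type u} [TopologicalSpace X] [TopologicalSpace S]

theorem openBox_inf (U U' : Opens X) (V V' : Opens S) :
    openBox U V ⊓ openBox U' V' = openBox (U ⊓ U') (V ⊓ V') :=
  Opens.ext Set.prod_inter_prod

theorem openBox_mono {U U' : Opens X} {V V' : Opens S} (hU : U ≤ U') (hV : V ≤ V') :
    openBox U V ≤ openBox U' V' :=
  Set.prod_mono hU hV

theorem IsFiniteSup.openBox {p : Opens X → Prop} {q : Opens S → Prop} {r : Opens (X × S) → Prop}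
    {U : Opens X} {V : Opens S} (hU : IsFiniteSup p U) (hV : IsFiniteSup q V)
    (h : ∀ A B, p A → q B → r (openBox A B)) : IsFiniteSup r (openBox U V) := by
  obtain ⟨𝓐, h𝓐, hp, rfl⟩ := hU
  obtain ⟨𝓑, h𝓑, hq, rfl⟩ := hV
  refine ⟨Set.image2 _root_.openBox 𝓐 𝓑, h𝓐.image2 _ h𝓑, ?_, le_antisymm ?_ (sSup_le ?_)⟩
  · rintro _ ⟨A, hA, B, hB, rfl⟩
    exact h A B (hp A hA) (hq B hB)
  · rintro ⟨x, s⟩ ⟨hx, hs⟩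
    obtain ⟨A, hA, hxA⟩ := Opens.mem_sSup.1 hx
    obtain ⟨B, hB, hsB⟩ := Opens.mem_sSup.1 hs
    exact Opens.mem_sSup.2 ⟨_, ⟨A, hA, B, hB, rfl⟩, hxA, hsB⟩
  · rintro _ ⟨A, hA, B, hB, rfl⟩
    exact openBox_mono (le_sSup hA) (le_sSup hB)

variable [ChartedSpace (EuclideanSpace ℝ (Fin n)) X] [ChartedSpace (EuclideanSpace ℝ (Fin d)) S]

variable (n) in
/-- `P = U × V` with `U` subanalytic open and `V` open: the objects of `X_sa × S` are the finite
suprema of such boxes. -/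
def IsSaOpenBox (P : Opens (X × S)) : Prop :=
  ∃ (U : Opens X) (V : Opens S), IsSubanalytic n (U : Set X) ∧ P = openBox U V

variable (n) in
/-- `P = A × B` with `A` relatively compact subanalytic and `B` relatively compact in some `D` such
that `A × D ⊆ O`. The side `A` need not be relatively compact in a larger set, since a covering in
`X_sa` is finite on the whole of `A`. -/
def IsBoxWellInside (O P : Opens (X × S)) : Prop :=
  ∃ (A : Opens X) (B D : Opens S), IsSubanalytic n (A : Set X) ∧ IsCompact (closure (A : Set X)) ∧
    CompactlyContained B D ∧ P = openBox A B ∧ openBox A D ≤ O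

variable (n) in
/-- `V` is a finite union of boxes that are well inside `O`. This is the topological description of
weak quasi-compactness in `X_sa × S`. -/
def WellInside (V O : Opens (X × S)) : Prop :=
  IsFiniteSup (IsBoxWellInside n O) V

theorem IsBoxWellInside.le {O P : Opens (X × S)} (h : IsBoxWellInside n O P) : P ≤ O := by
  obtain ⟨A, B, D, -, -, hBD, rfl, hO⟩ := h
  exact (openBox_mono le_rfl hBD.le).trans hO

theorem IsBoxWellInside.isCompact_closure [T2Space X] [T2Space S] {O P : Opens (X × S)}
    (h : IsBoxWellInside n O P) : IsCompact (closure (P : Set (X × S))) := by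
  obtain ⟨A, B, D, -, hA, hBD, rfl, -⟩ := h
  exact (hA.prod hBD.1).closure_of_subset (Set.prod_mono subset_closure subset_closure)

namespace WellInside

variable {V V' O O' : Opens (X × S)}

theorem le (h : WellInside n V O) : V ≤ O :=
  IsFiniteSup.induction h bot_le (fun _ _ => sup_le) fun _ hP => hP.le

theorem mono_right (h : WellInside n V O) (hO : O ≤ O') : WellInside n V O' :=
  IsFiniteSup.mono h fun _ _ ⟨A, B, D, hA, hAc, hBD, hP, hAD⟩ =>
    ⟨A, B, D, hA, hAc, hBD, hP, hAD.trans hO⟩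

theorem isFiniteSup (h : WellInside n V O) : IsFiniteSup (IsSaOpenBox n) V :=
  IsFiniteSup.mono h fun _ _ ⟨A, B, _, hA, _, _, hP, _⟩ => ⟨A, B, hA, hP⟩

theorem isCompact_closure [T2Space X] [T2Space S] (h : WellInside n V O) :
    IsCompact (closure (V : Set (X × S))) := by
  refine IsFiniteSup.induction h (by simp) (fun P Q hP hQ => ?_) fun P hP => hP.isCompact_closure
  rw [Opens.coe_sup, closure_union]
  exact hP.union hQ

theorem exists_between [T2Space S] [IsManifold (𝓡 d) ω S] (h : WellInside n V O) :
    ∃ P, IsFiniteUnionOfSaBoxes n d P ∧ WellInside n V P ∧ WellInside n P O := by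
  refine IsFiniteSup.induction h ⟨⊥, IsFiniteSup.bot, .bot, .bot⟩ ?_ ?_
  · rintro V V' ⟨P, hP, hVP, hPO⟩ ⟨P', hP', hVP', hPO'⟩
    exact ⟨P ⊔ P', IsFiniteSup.sup hP hP',
      IsFiniteSup.sup (hVP.mono_right le_sup_left) (hVP'.mono_right le_sup_right), hPO.sup hPO'⟩
  · rintro _ ⟨A, B, D, hA, hAc, hBD, rfl, hAD⟩
    obtain ⟨E, hBE, hE⟩ := exists_isFiniteSup_of_isCompact hBD.1 fun s hs =>
      exists_mem_isSubanalytic_compactlyContained (n := d) (hBD.2 hs)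
    have hA' : IsFiniteSup (· = A) A := .of rfl
    refine ⟨openBox A E, hA'.openBox hE ?_, .of ⟨A, B, E, hA, hAc, ⟨hBD.1, hBE⟩, rfl, le_rfl⟩,
      hA'.openBox hE ?_⟩
    · rintro _ F rfl ⟨hF, hFD⟩
      exact ⟨_, F, hA, hAc, hF, hFD.1, rfl⟩
    · rintro _ F rfl ⟨-, hFD⟩
      exact ⟨_, F, D, hA, hAc, hFD, rfl, hAD⟩

variable [T2Space X]

theorem le_inf (h : WellInside n V O) (h' : WellInside n V O') : WellInside n V (O ⊓ O') := by
  rw [← inf_idem V]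
  refine IsFiniteSup.inf ?_ h h'
  rintro _ _ ⟨A, B, D, hA, hAc, hBD, rfl, hAD⟩ ⟨A', B', D', hA', -, hBD', rfl, hAD'⟩
  exact ⟨A ⊓ A', B ⊓ B', D ⊓ D', hA.inter hA', isCompact_closure_of_le hAc inf_le_left,
    hBD.inf hBD', openBox_inf A A' B B', openBox_inf A A' D D' ▸ inf_le_inf hAD hAD'⟩

theorem mono_left (h : WellInside n V O) (hV' : IsFiniteSup (IsSaOpenBox n) V') (hV : V' ≤ V) :
    WellInside n V' O := by
  rw [← inf_eq_right.2 hV]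
  refine IsFiniteSup.inf ?_ h hV'
  rintro _ _ ⟨A, B, D, hA, hAc, hBD, rfl, hAD⟩ ⟨A', B', hA', rfl⟩
  exact ⟨A ⊓ A', B ⊓ B', D, hA.inter hA', isCompact_closure_of_le hAc inf_le_left,
    hBD.mono_left inf_le_left, openBox_inf A A' B B', (openBox_mono inf_le_left le_rfl).trans hAD⟩

theorem exists_opSa_le {W W' : OpSa n X S} (h : WellInside n V W.1) (h' : WellInside n V W'.1) :
    ∃ W'' ≤ W, W'' ≤ W' ∧ WellInside n V W''.1 := by
  refine ⟨⟨W.1 ⊓ W'.1, IsFiniteSup.inf ?_ W.2 W'.2⟩, inf_le_left (a := W.1),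
    inf_le_right (a := W.1), h.le_inf h'⟩
  rintro _ _ ⟨A, B, hA, rfl⟩ ⟨A', B', hA', rfl⟩
  exact ⟨A ⊓ A', B ⊓ B', hA.inter hA', openBox_inf A A' B B'⟩

end WellInside

theorem IsFiniteUnionOfSaBoxes.inf [T2Space X] [T2Space S] {V V' : Opens (X × S)}
    (h : IsFiniteUnionOfSaBoxes n d V) (h' : IsFiniteUnionOfSaBoxes n d V') :
    IsFiniteUnionOfSaBoxes n d (V ⊓ V') := by
  refine IsFiniteSup.inf ?_ h h'
  rintro _ _ ⟨A, B, hA, hAc, hB, hBc, rfl⟩ ⟨A', B', hA', -, hB', -, rfl⟩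
  exact ⟨A ⊓ A', B ⊓ B', hA.inter hA', isCompact_closure_of_le hAc inf_le_left, hB.inter hB',
    isCompact_closure_of_le hBc inf_le_left, openBox_inf A A' B B'⟩

theorem IsFiniteUnionOfSaBoxes.isFiniteSup {V : Opens (X × S)}
    (h : IsFiniteUnionOfSaBoxes n d V) : IsFiniteSup (IsSaOpenBox n) V :=
  IsFiniteSup.mono h fun _ _ ⟨A, B, hA, _, _, _, hP⟩ => ⟨A, B, hA, hP⟩

end Boxes

section SaTopology

variable {n : ℕ} {X S : Type u} [TopologicalSpace X] [TopologicalSpace S]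
  [ChartedSpace (EuclideanSpace ℝ (Fin n)) X] {U V : OpSa n X S}

theorem mem_saTopology_of_saCoverings {R : Sieve U}
    (h : {W | ∃ f : W ⟶ U, R f} ∈ saCoverings n X S U) : R ∈ saTopology n X S U := by
  rw [← Sieve.generate_sieve R]
  exact Precoverage.generate_mem_toGrothendieck (J := { coverings := _ }) h

variable [T2Space X]

/-- The cells of the sides of the given boxes form a product covering that refines them. -/
theorem mem_saTopology_of_isFiniteSup {R : Sieve U}
    (h : IsFiniteSup (fun P => IsSaOpenBox n P ∧ ∃ (W : OpSa n X S) (f : W ⟶ U), R f ∧ P ≤ W.1)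
      U.1) : R ∈ saTopology n X S U := by
  classical
  obtain ⟨𝓑, hfin, h𝓑, hU⟩ := h
  choose! A B hA hP using fun P hP𝓑 => (h𝓑 P hP𝓑).1
  refine mem_saTopology_of_saCoverings fun U' V' hU' hle => ?_
  let 𝓐 : Finset (Opens X) := hfin.toFinset.image A
  let 𝓓 : Finset (Opens S) := hfin.toFinset.image B
  have h𝓐 : ∀ P ∈ 𝓑, A P ∈ 𝓐 := fun P hP => Finset.mem_image_of_mem A (hfin.mem_toFinset.2 hP)
  have h𝓓 : ∀ P ∈ 𝓑, B P ∈ 𝓓 := fun P hP => Finset.mem_image_of_mem B (hfin.mem_toFinset.2 hP)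
  refine ⟨(fun x => U' ⊓ cell 𝓐 x) '' U', (fun s => V' ⊓ cell 𝓓 s) '' V',
    isSaCovering_image_inf_cell hU' ?_, sSup_image_inf_cell 𝓓 V', ?_⟩
  · simpa [𝓐] using hA
  · rintro _ ⟨x, hx, rfl⟩ _ ⟨s, hs, rfl⟩
    obtain ⟨P, hP𝓑, hxs⟩ := Opens.mem_sSup.1 (hU ▸ hle ⟨hx, hs⟩ : (x, s) ∈ sSup 𝓑)
    have hxs' : (x, s) ∈ openBox (A P) (B P) := hP P hP𝓑 ▸ hxs
    obtain ⟨W, f, hf, hPW⟩ := (h𝓑 P hP𝓑).2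
    refine ⟨W, ⟨f, hf⟩, le_trans ?_ hPW⟩
    rw [hP P hP𝓑]
    exact openBox_mono (inf_le_right.trans (cell_le (h𝓐 P hP𝓑) hxs'.1))
      (inf_le_right.trans (cell_le (h𝓓 P hP𝓑) hxs'.2))

variable (n X S) in
/-- The topology on `op(X_sa × S)` whose covering sieves of `U` are those that cover every `V` well
inside `U` by finitely many sets, each well inside an object of the sieve. It is finer than that of
the site, and thereby controls the coverings obtained by transitivity. -/
def wellInsideTopology : GrothendieckTopology (OpSa n X S) where
  sieves U := {R | ∀ V, WellInside n V U.1 →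
    IsFiniteSup (fun V' => ∃ (W : OpSa n X S) (f : W ⟶ U), R f ∧ WellInside n V' W.1) V}
  top_mem' U V hV := .of ⟨U, 𝟙 U, trivial, hV⟩
  pullback_stable' U U' R f hR V hV := by
    refine (hR V (hV.mono_right (leOfHom f))).mono ?_
    rintro V' hV'V ⟨W, g, hg, hV'W⟩
    obtain ⟨W', hW'W, hW'U', hV'W'⟩ := hV'W.exists_opSa_le (hV.mono_left hV'W.isFiniteSup hV'V)
    exact ⟨W', homOfLE hW'U', R.downward_closed hg (homOfLE hW'W), hV'W'⟩
  transitive' U R hR R' h V hV :=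
    (hR V hV).bind fun V' _ ⟨W, f, hf, hV'W⟩ => (h hf V' hV'W).mono
      fun V'' _ ⟨W', g, hg, hV''W'⟩ => ⟨W', g ≫ f, hg, hV''W'⟩

variable [LocallyCompactSpace S] [T2Space S]

variable (n X S) in
theorem saTopology_le_wellInsideTopology : saTopology n X S ≤ wellInsideTopology n X S := by
  refine Precoverage.toGrothendieck_le_iff_le_toPrecoverage.2 fun U R hR V hV =>
    IsFiniteSup.bind hV ?_
  rintro _ - ⟨A, B, D, hA, hAc, hBD, rfl, hAD⟩
  obtain ⟨𝒰, 𝒱, h𝒰, rfl, hR⟩ := hR A D hA hAD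
  obtain ⟨E, hBE, hE⟩ := exists_isFiniteSup_of_isCompact
    (p := fun F => ∃ V' ∈ 𝒱, CompactlyContained F V') hBD.1 fun s hs =>
      let ⟨V', hV', hsV'⟩ := Opens.mem_sSup.1 (hBD.2 hs)
      (exists_mem_compactlyContained hsV').imp fun _ hF => ⟨hF.1, V', hV', hF.2⟩
  have hB : IsFiniteSup (fun F => ∃ V' ∈ 𝒱, CompactlyContained F V') B :=
    hE.of_le (subset_closure.trans hBE) fun F ⟨V', hV', hF⟩ =>
      ⟨V', hV', hF.mono_left inf_le_left⟩
  refine (h𝒰.isFiniteSup hAc).openBox hB ?_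
  rintro U' F hU' ⟨V', hV', hF⟩
  obtain ⟨W, ⟨f, hf⟩, hW⟩ := hR U' hU' V' hV'
  exact ⟨W, f, Sieve.le_generate R _ _ hf, .of ⟨U', F, V', (h𝒰.1 U' hU').1,
    isCompact_closure_of_le hAc (h𝒰.1 U' hU').2, hF, rfl, hW⟩⟩

/-- The sieve of the objects well inside `U`. -/
def wellInsideSieve (U : OpSa n X S) : Sieve U where
  arrows W _ := WellInside n W.1 U.1
  downward_closed {_ W _} h g := WellInside.mono_left h W.2 (leOfHom g)

variable [IsManifold (𝓡 n) ω X]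

theorem wellInsideSieve_mem_saTopology (U : OpSa n X S) :
    wellInsideSieve U ∈ saTopology n X S U := by
  refine mem_saTopology_of_saCoverings fun U' V' hU' hle =>
    ⟨_, _, isSaCovering_setOf_isCompact_closure hU', sSup_setOf_compactlyContained V', ?_⟩
  rintro A ⟨⟨hA, hAU'⟩, hAc⟩ B hB
  have h : WellInside n (openBox A B) U.1 :=
    .of ⟨A, B, V', hA, hAc, hB, rfl, (openBox_mono hAU' le_rfl).trans hle⟩
  exact ⟨⟨openBox A B, h.isFiniteSup⟩, ⟨homOfLE h.le, h⟩, le_rfl⟩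

theorem exists_mem_wellInside {p : X × S} (hp : p ∈ U.1) : ∃ V, p ∈ V ∧ WellInside n V U.1 := by
  obtain ⟨𝓑, -, h𝓑, hU⟩ := U.2
  obtain ⟨_, hP, hpP⟩ := Opens.mem_sSup.1 (hU ▸ hp)
  obtain ⟨A, D, -, rfl⟩ := h𝓑 _ hP
  obtain ⟨A', hpA', hA', hA'A⟩ := exists_mem_isSubanalytic_compactlyContained (n := n) hpP.1
  obtain ⟨B, hpB, hBD⟩ := exists_mem_compactlyContained hpP.2
  exact ⟨openBox A' B, ⟨hpA', hpB⟩, .of ⟨A', B, D, hA', hA'A.1, hBD, rfl,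
    (openBox_mono hA'A.le le_rfl).trans (hU ▸ le_sSup hP)⟩⟩

theorem eq_sSup_of_generate_mem_saTopology {T : Set (OpSa n X S)} (hTU : ∀ W ∈ T, W ≤ U)
    (hT : Sieve.generate (X := U) (fun W _ => W ∈ T) ∈ saTopology n X S U) :
    U.1 = sSup (Subtype.val '' T) := by
  refine le_antisymm (fun p hp => ?_) (sSup_le ?_)
  · obtain ⟨V, hpV, hVU⟩ := exists_mem_wellInside hp
    obtain ⟨𝓕, -, h𝓕, rfl⟩ := saTopology_le_wellInsideTopology n X S U hT V hVU
    obtain ⟨V', hV', hpV'⟩ := Opens.mem_sSup.1 hpV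
    obtain ⟨W, -, ⟨W', g, -, hW', -⟩, hV'W⟩ := h𝓕 V' hV'
    exact Opens.mem_sSup.2 ⟨W'.1, ⟨W', hW', rfl⟩, leOfHom g (hV'W.le hpV')⟩
  · rintro _ ⟨W, hW, rfl⟩
    exact hTU W hW

theorem IsWeaklyQuasiCompactIn.wellInside
    (h : IsWeaklyQuasiCompactIn (saTopology n X S) V U) : WellInside n V.1 U.1 := by
  obtain ⟨hVU, h⟩ := h
  obtain ⟨T, hT, hTU, hTV⟩ := h _ (wellInsideSieve_mem_saTopology U)
  have hV : IsFiniteSup (fun W => WellInside n W U.1) V.1 := by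
    refine ⟨_, hT.image _, ?_,
      eq_sSup_of_generate_mem_saTopology (fun W hW => (hTU W hW).choose) hTV⟩
    rintro _ ⟨W, hW, rfl⟩
    exact (hTU W hW).choose_spec
  exact hV.bind fun _ _ hW => hW

omit [IsManifold (𝓡 n) ω X] in
theorem WellInside.isWeaklyQuasiCompactIn (h : WellInside n V.1 U.1) :
    IsWeaklyQuasiCompactIn (saTopology n X S) V U := by
  refine ⟨h.le, fun R hR => ?_⟩
  obtain ⟨𝓕, hfin, h𝓕, hV⟩ := saTopology_le_wellInsideTopology n X S U hR V.1 h
  refine ⟨{W | W.1 ∈ 𝓕}, hfin.preimage Subtype.val_injective.injOn, fun W hW => ?_, ?_⟩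
  · obtain ⟨W', f, hf, hWW'⟩ := h𝓕 W.1 hW
    have hWV : W.1 ≤ V.1 := hV ▸ le_sSup hW
    exact ⟨hWV, R.downward_closed hf (homOfLE hWW'.le)⟩
  · have hV𝓕 : IsFiniteSup (· ∈ 𝓕) V.1 := ⟨𝓕, hfin, fun _ => id, hV⟩
    refine mem_saTopology_of_isFiniteSup (hV𝓕.bind fun V' hV'V hV' => ?_)
    obtain ⟨W, -, -, hV'W⟩ := h𝓕 V' hV'
    let V₀ : OpSa n X S := ⟨V', hV'W.isFiniteSup⟩
    exact hV'W.isFiniteSup.mono fun P hP hPbox => ⟨hPbox, V₀, homOfLE hV'V,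
      Sieve.le_generate _ _ _ hV', hP⟩

end SaTopology

/-! ### Presheaves of modules on a preorder -/

section PresheafRes

variable {R C : Type*} [Ring R] [Preorder C]

/-- The restriction map of a presheaf of modules on a preorder. -/
def presheafRes (F : Cᵒᵖ ⥤ ModuleCat.{u} R) {P Q : C} (h : P ≤ Q) :
    F.obj (op Q) →ₗ[R] F.obj (op P) :=
  (F.map (homOfLE h).op).hom

theorem presheafRes_self (F : Cᵒᵖ ⥤ ModuleCat.{u} R) {P : C} (h : P ≤ P) (x : F.obj (op P)) :
    presheafRes F h x = x := by
  simp [presheafRes]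

theorem presheafRes_presheafRes (F : Cᵒᵖ ⥤ ModuleCat.{u} R) {P Q Q' : C} (h : P ≤ Q)
    (h' : Q ≤ Q') (x : F.obj (op Q')) :
    presheafRes F h (presheafRes F h' x) = presheafRes F (h.trans h') x := by
  simp only [presheafRes, ← homOfLE_comp h h', op_comp, F.map_comp, ModuleCat.hom_comp,
    LinearMap.comp_apply]

theorem app_presheafRes {F G : Cᵒᵖ ⥤ ModuleCat.{u} R} (φ : F ⟶ G) {P Q : C} (h : P ≤ Q)
    (x : F.obj (op Q)) :
    (φ.app (op P)).hom (presheafRes F h x) = presheafRes G h ((φ.app (op Q)).hom x) :=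
  NatTrans.naturality_apply φ (homOfLE h).op x

end PresheafRes

section SectionsOn

variable {R : Type*} [Ring R] {C : Type u} [Preorder C] (F : Cᵒᵖ ⥤ ModuleCat.{u} R)

/-- The compatible families of sections of `F` over the members of `L`, that is, the limit of `F`
over `L`. -/
def sectionsOn (L : LowerSet C) : Submodule R (∀ P : L, F.obj (op P.1)) where
  carrier := {s | ∀ (P Q : L) (h : P.1 ≤ Q.1), presheafRes F h (s Q) = s P}
  add_mem' hs ht P Q h := by simp [hs P Q h, ht P Q h]
  zero_mem' P Q h := by simp
  smul_mem' c s hs P Q h := by simp [hs P Q h]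

variable {F} in
theorem sectionsOn_ext {L : LowerSet C} {s t : sectionsOn F L} (h : ∀ P, s.1 P = t.1 P) : s = t :=
  Subtype.ext (funext h)

/-- The restriction of compatible families to a smaller lower set. -/
def resSections {L L' : LowerSet C} (h : L ≤ L') : sectionsOn F L' →ₗ[R] sectionsOn F L :=
  (LinearMap.pi fun P : L => LinearMap.proj (⟨P.1, h P.2⟩ : L')).restrict
    fun _ hs P Q hPQ => hs ⟨P.1, h P.2⟩ ⟨Q.1, h Q.2⟩ hPQ

/-- The presheaf `L ↦ sectionsOn F L` on the lower sets of `C`. -/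
def sectionsPresheaf : (LowerSet C)ᵒᵖ ⥤ ModuleCat.{u} R where
  obj L := ModuleCat.of R (sectionsOn F L.unop)
  map f := ModuleCat.ofHom (resSections F (leOfHom f.unop))

theorem exists_sectionsOn_iSup {ι : Type*} {L : ι → LowerSet C} (s : ∀ i, sectionsOn F (L i))
    (hs : ∀ i j P (hi : P ∈ L i) (hj : P ∈ L j), (s i).1 ⟨P, hi⟩ = (s j).1 ⟨P, hj⟩) :
    ∃ t : sectionsOn F (⨆ i, L i), ∀ i, resSections F (le_iSup L i) t = s i := by
  have hL : ∀ P : (⨆ i, L i : LowerSet C), ∃ i, P.1 ∈ L i := fun P => LowerSet.mem_iSup_iff.1 P.2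
  choose i hi using hL
  refine ⟨⟨fun P => (s (i P)).1 ⟨P.1, hi P⟩, fun P Q hPQ => ?_⟩, fun j => sectionsOn_ext fun P =>
    hs _ _ P.1 _ _⟩
  exact ((s (i Q)).2 ⟨P.1, (L (i Q)).lower hPQ (hi Q)⟩ ⟨Q.1, hi Q⟩ hPQ).trans (hs _ _ P.1 _ _)

variable {F} in
theorem sectionsOn_iSup_ext {ι : Type*} {L : ι → LowerSet C} {s t : sectionsOn F (⨆ i, L i)}
    (h : ∀ i, resSections F (le_iSup L i) s = resSections F (le_iSup L i) t) : s = t :=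
  sectionsOn_ext fun P =>
    let ⟨i, hi⟩ := LowerSet.mem_iSup_iff.1 P.2
    congrFun (congrArg Subtype.val (h i)) ⟨P.1, hi⟩

/-- The sieve on `P` of the members of `L`. -/
def lowerSetSieve (L : LowerSet C) (P : C) : Sieve P where
  arrows Q _ := Q ∈ L
  downward_closed h g := L.lower (leOfHom g) h

theorem isSheaf_comp_forget {J : GrothendieckTopology C} (F : Sheaf J (ModuleCat.{u} R)) :
    Presieve.IsSheaf J (F.obj ⋙ forget (ModuleCat.{u} R)) :=
  (isSheaf_iff_isSheaf_of_type J _).1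
    ((Presheaf.isSheaf_iff_isSheaf_forget J F.obj (forget _)).1 F.property)

theorem resSections_bijective_of_covering {J : GrothendieckTopology C}
    (F : Sheaf J (ModuleCat.{u} R)) {L L' : LowerSet C} (h : L ≤ L')
    (hJ : ∀ P ∈ L', lowerSetSieve L P ∈ J P) : Function.Bijective (resSections F.obj h) := by
  have hF := fun P hP => isSheaf_comp_forget F (lowerSetSieve L P) (hJ P hP)
  have hsep {P : C} (hP : P ∈ L') {x y : F.obj.obj (op P)}
      (hxy : ∀ Q (_ : Q ∈ L) (hQP : Q ≤ P), presheafRes F.obj hQP x = presheafRes F.obj hQP y) :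
      x = y :=
    (hF P hP).isSeparatedFor.ext fun Q f hQ => hxy Q hQ (leOfHom f)
  refine ⟨fun s t hst => sectionsOn_ext fun P => hsep P.2 fun Q hQ hQP => ?_, fun t => ?_⟩
  · rw [s.2 ⟨Q, h hQ⟩ P hQP, t.2 ⟨Q, h hQ⟩ P hQP]
    exact congrFun (congrArg Subtype.val hst) ⟨Q, hQ⟩
  · have hglue (P : L') : ∃ x : F.obj.obj (op P.1),
        ∀ Q (hQ : Q ∈ L) (hQP : Q ≤ P.1), presheafRes F.obj hQP x = t.1 ⟨Q, hQ⟩ := by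
      obtain ⟨x, hx, -⟩ := hF P.1 P.2 (fun Q _ hQ => t.1 ⟨Q, hQ⟩) fun Q Q' Z g g' _ _ hQ hQ' _ =>
        (t.2 ⟨Z, L.lower (leOfHom g) hQ⟩ ⟨Q, hQ⟩ (leOfHom g)).trans
          (t.2 ⟨Z, L.lower (leOfHom g) hQ⟩ ⟨Q', hQ'⟩ (leOfHom g')).symm
      exact ⟨x, fun Q hQ hQP => hx (homOfLE hQP) hQ⟩
    choose s hs using hglue
    refine ⟨⟨s, fun P Q hPQ => hsep P.2 fun Z hZ hZP => ?_⟩, sectionsOn_ext fun P => ?_⟩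
    · rw [presheafRes_presheafRes, hs Q Z hZ, hs P Z hZ]
    · have hP := hs ⟨P.1, h P.2⟩ P.1 P.2 le_rfl
      rwa [presheafRes_self] at hP

theorem isSheaf_comp_sectionsPresheaf {D : Type u} [Preorder D] {J : GrothendieckTopology C}
    {K : GrothendieckTopology D} (F : Sheaf J (ModuleCat.{u} R)) (I : D ⥤ LowerSet C)
    (hinter : ∀ W W' P, P ∈ I.obj W → P ∈ I.obj W' → ∃ W'' ≤ W, W'' ≤ W' ∧ P ∈ I.obj W'')
    (hcover : ∀ U, ∀ T ∈ K U, ∀ P ∈ I.obj U,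
      lowerSetSieve (⨆ W : {W // ∃ f : W ⟶ U, T f}, I.obj W.1) P ∈ J P) :
    Presheaf.IsSheaf K (I.op ⋙ sectionsPresheaf F.obj) := by
  rw [Presheaf.isSheaf_iff_isSheaf_forget _ _ (forget _), isSheaf_iff_isSheaf_of_type]
  intro U T hT x hx
  let L : {W // ∃ f : W ⟶ U, T f} → LowerSet C := fun W => I.obj W.1
  let y : ∀ W, sectionsOn F.obj (L W) := fun W => x W.2.choose W.2.choose_spec
  have hx_eq {W} (f g : W ⟶ U) (hf : T f) (hg : T g) : x f hf = x g hg := by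
    obtain rfl := Subsingleton.elim f g
    rfl
  have hLU : ⨆ W, L W ≤ I.obj U := iSup_le fun W => I.monotone (leOfHom W.2.choose)
  have hy : ∀ W W' P (hP : P ∈ L W) (hP' : P ∈ L W'), (y W).1 ⟨P, hP⟩ = (y W').1 ⟨P, hP'⟩ := by
    rintro ⟨W, hW⟩ ⟨W', hW'⟩ P hP hP'
    obtain ⟨W'', hWW, hWW', hP''⟩ := hinter W W' P hP hP'
    exact congrFun (congrArg Subtype.val (hx (homOfLE hWW) (homOfLE hWW') hW.choose_spec
      hW'.choose_spec rfl)) ⟨P, hP''⟩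
  obtain ⟨t, ht⟩ := exists_sectionsOn_iSup F.obj y hy
  obtain ⟨hinj, hsurj⟩ := resSections_bijective_of_covering F hLU (hcover U T hT)
  obtain ⟨s, hs⟩ := hsurj t
  refine ⟨s, fun W f hf => ?_, fun s' hs' => hinj (sectionsOn_iSup_ext fun W => ?_)⟩
  · exact (congrArg (resSections F.obj (le_iSup L ⟨W, f, hf⟩)) hs).trans
      ((ht ⟨W, f, hf⟩).trans (hx_eq _ f _ hf))
  · rw [hs, ht]
    exact hs' _ W.2.choose_spec

end SectionsOn

/-! ### Comparison with the left Kan extension -/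

section LeftKanExtension

variable {R : Type*} [Ring R] {C E : Type u} [Preorder C] [Preorder E]
  (F : Cᵒᵖ ⥤ ModuleCat.{u} R) {ι : C ⥤ E} {I : E ⥤ LowerSet C}

/-- The restriction of the sections of `F` over `P` to the members of `I.obj (ι.obj P)`. -/
def toSectionsOn (hI : ∀ P, I.obj (ι.obj P) ≤ LowerSet.Iic P) :
    F ⟶ ι.op ⋙ I.op ⋙ sectionsPresheaf F where
  app P := ModuleCat.ofHom <|
    (LinearMap.pi fun Q : I.obj (ι.obj P.unop) => presheafRes F (hI _ Q.2)).codRestrict _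
      fun s Q Q' h => presheafRes_presheafRes F h (hI _ Q'.2) s
  naturality P P' f := by
    ext s
    exact sectionsOn_ext fun Q => presheafRes_presheafRes F (hI _ Q.2) (leOfHom f.unop) s

/-- The map from the left Kan extension of `F` along `ι` to the sections of `F` over the members of
`I`, adjoint to `toSectionsOn`. -/
noncomputable def lanToSections (hI : ∀ P, I.obj (ι.obj P) ≤ LowerSet.Iic P) :
    ι.op.lan.obj F ⟶ I.op ⋙ sectionsPresheaf F :=
  (ι.op.lan.obj F).descOfIsLeftKanExtension (ι.op.lanUnit.app F) _ (toSectionsOn F hI)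

variable {F} (hI : ∀ P, I.obj (ι.obj P) ≤ LowerSet.Iic P)

theorem lanToSections_lanUnit {P : C} (s : F.obj (op P)) :
    ((lanToSections F hI).app (op (ι.obj P))).hom (((ι.op.lanUnit.app F).app (op P)).hom s) =
      ((toSectionsOn F hI).app (op P)).hom s :=
  congrArg (fun φ => φ.hom s) <| (ι.op.lan.obj F).descOfIsLeftKanExtension_fac_app
    (ι.op.lanUnit.app F) _ (toSectionsOn F hI) (op P)

theorem exists_lanToSections_eq {U W : E} (s : sectionsOn F (I.obj U)) {P : C} (hP : P ∈ I.obj U)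
    (hWP : W ≤ ι.obj P) (hWU : W ≤ U) :
    ∃ z, ((lanToSections F hI).app (op W)).hom z =
      presheafRes (I.op ⋙ sectionsPresheaf F) hWU s := by
  refine ⟨presheafRes (ι.op.lan.obj F) hWP
    (((ι.op.lanUnit.app F).app (op P)).hom (s.1 ⟨P, hP⟩)), ?_⟩
  rw [app_presheafRes, lanToSections_lanUnit]
  exact sectionsOn_ext fun Q => s.2 ⟨Q.1, I.monotone hWU Q.2⟩ ⟨P, hP⟩ (hI P (I.monotone hWP Q.2))

theorem presheafRes_eq_of_lanToSections_eq [ι.Full] [ι.Faithful] {U W : E}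
    {x y : (ι.op.lan.obj F).obj (op U)}
    (hxy : ((lanToSections F hI).app (op U)).hom x = ((lanToSections F hI).app (op U)).hom y)
    {P Q : C} (hPU : ι.obj P ≤ U) (hQ : Q ∈ I.obj (ι.obj P)) (hWQ : W ≤ ι.obj Q) (hWU : W ≤ U) :
    presheafRes (ι.op.lan.obj F) hWU x = presheafRes (ι.op.lan.obj F) hWU y := by
  have hunit : Function.Surjective ((ι.op.lanUnit.app F).app (op P)).hom :=
    ((ConcreteCategory.isIso_iff_bijective ((ι.op.lanUnit.app F).app (op P))).1 inferInstance).2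
  obtain ⟨s, hs⟩ := hunit (presheafRes _ hPU x)
  obtain ⟨t, ht⟩ := hunit (presheafRes _ hPU y)
  have hst : presheafRes F (hI P hQ) s = presheafRes F (hI P hQ) t := by
    have h : ((toSectionsOn F hI).app (op P)).hom s = ((toSectionsOn F hI).app (op P)).hom t := by
      rw [← lanToSections_lanUnit, ← lanToSections_lanUnit, hs, ht, app_presheafRes,
        app_presheafRes, hxy]
    exact congrFun (congrArg Subtype.val h) ⟨Q, hQ⟩
  have hQP : ι.obj Q ≤ ι.obj P := ι.monotone (hI P hQ)
  have hunit_res (r : F.obj (op P)) :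
      ((ι.op.lanUnit.app F).app (op Q)).hom (presheafRes F (hI P hQ) r) =
        presheafRes (ι.op.lan.obj F) hQP (((ι.op.lanUnit.app F).app (op P)).hom r) :=
    app_presheafRes (ι.op.lanUnit.app F) (hI P hQ) r
  have hQxy : presheafRes (ι.op.lan.obj F) (hQP.trans hPU) x =
      presheafRes (ι.op.lan.obj F) (hQP.trans hPU) y := by
    rw [← presheafRes_presheafRes _ hQP hPU x, ← presheafRes_presheafRes _ hQP hPU y, ← hs, ← ht,
      ← hunit_res, ← hunit_res, hst]
  rw [← presheafRes_presheafRes _ hWQ (hQP.trans hPU) x, hQxy, presheafRes_presheafRes]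

end LeftKanExtension

/-! ### c-softness -/

section CSoft

theorem surjective_colimit_ι {R J : Type*} [Ring R] [Category* J] {G : J ⥤ ModuleCat.{u} R}
    [HasColimit G] {j : J}
    (h : ∀ i (s : G.obj i), ∃ t, (colimit.ι G j).hom t = (colimit.ι G i).hom s) :
    Function.Surjective (colimit.ι G j).hom := by
  refine (ModuleCat.epi_iff_surjective _).1 (Preadditive.epi_of_cancel_zero _ fun g hg => ?_)
  refine colimit.hom_ext fun i => ?_
  ext s
  obtain ⟨t, ht⟩ := h i s
  have hgt : g.hom ((colimit.ι G j).hom t) = 0 := congrArg (fun φ => φ.hom t) hg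
  rw [ht] at hgt
  simpa using hgt

variable {C : Type u} [Preorder C] {J : GrothendieckTopology C}

theorem germSystem_ι_presheafRes (G : Sheaf J (ModuleCat.{u} ℂ)) {V P U : C}
    (hP : IsWeaklyQuasiCompactIn J V P) (hU : IsWeaklyQuasiCompactIn J V U) (hPU : P ≤ U)
    (s : G.obj.obj (op U)) :
    (colimit.ι (germSystem G V) (op ⟨P, hP⟩)).hom (presheafRes G.obj hPU s) =
      (colimit.ι (germSystem G V) (op ⟨U, hU⟩)).hom s :=
  congrArg (fun φ => φ.hom s) (colimit.w (germSystem G V)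
    (homOfLE (show (⟨P, hP⟩ : WeaklyQuasiCompactNhd J V) ≤ ⟨U, hU⟩ from hPU)).op)

theorem isCSoft_of_forall_exists {G : Sheaf J (ModuleCat.{u} ℂ)}
    (h : ∀ V U W : C, IsWeaklyQuasiCompactIn J V U → IsWeaklyQuasiCompactIn J V W →
      ∀ s : G.obj.obj (op U), ∃ (P : C) (hPU : P ≤ U) (hPW : P ≤ W) (t : G.obj.obj (op W)),
        IsWeaklyQuasiCompactIn J V P ∧ presheafRes G.obj hPW t = presheafRes G.obj hPU s) :
    IsCSoft G := by
  intro Y V W _ _ hVW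
  refine surjective_colimit_ι fun U s => ?_
  obtain ⟨P, hPU, hPW, t, hP, ht⟩ := h V U.unop.1 W U.unop.2 hVW s
  refine ⟨t, ?_⟩
  rw [← germSystem_ι_presheafRes G hP hVW hPW, ht]
  exact germSystem_ι_presheafRes G hP U.unop.2 hPU s

theorem IsCSoft.of_iso {F G : Sheaf J (ModuleCat.{u} ℂ)} (e : F ≅ G) (hF : IsCSoft F) :
    IsCSoft G := by
  intro Y V W hVY hWY hVW
  let w : germSystem F V ≅ germSystem G V :=
    Functor.isoWhiskerLeft _ ((sheafToPresheaf J _).mapIso e)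
  have hF_epi : Epi (colimit.ι (germSystem F V) (op ⟨W, hVW⟩)) :=
    (ModuleCat.epi_iff_surjective _).2 (hF Y V W hVY hWY hVW)
  have hcomp := HasColimit.isoOfNatIso_ι_hom w (op ⟨W, hVW⟩)
  exact (ModuleCat.epi_iff_surjective _).1 (epi_of_epi_fac hcomp.symm)

end CSoft

/-! ### The inverse image of a sheaf on `X_sa × S_sa` -/

section InverseImage

variable {n d : ℕ} {X S : Type u} [TopologicalSpace X] [TopologicalSpace S]
  [ChartedSpace (EuclideanSpace ℝ (Fin n)) X] [ChartedSpace (EuclideanSpace ℝ (Fin d)) S]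

theorem OpSaSa.isFiniteUnionOfSaBoxes_of_isCompact_closure {P : OpSaSa n d X S}
    (hP : IsCompact (closure (P.1 : Set (X × S)))) : IsFiniteUnionOfSaBoxes n d P.1 := by
  obtain ⟨𝓑, h𝓑, hfin, hP𝓑⟩ := P.2
  refine ⟨Subtype.val '' {Q : 𝓑 | ((Q : Set (X × S)) ∩ closure P.1).Nonempty},
    (hfin.finite_nonempty_inter_compact hP).image _, ?_, ?_⟩
  · rintro _ ⟨Q, -, rfl⟩
    exact h𝓑 Q Q.2
  · refine le_antisymm (fun p hp => ?_) (sSup_le ?_)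
    · obtain ⟨Q, hQ, hpQ⟩ := Opens.mem_sSup.1 (hP𝓑 ▸ hp : p ∈ sSup 𝓑)
      exact Opens.mem_sSup.2 ⟨Q, ⟨⟨Q, hQ⟩, ⟨p, hpQ, subset_closure hp⟩, rfl⟩, hpQ⟩
    · rintro _ ⟨Q, -, rfl⟩
      exact hP𝓑 ▸ le_sSup Q.2

theorem IsFiniteUnionOfSaBoxes.exists_opSaSa_eq {V : Opens (X × S)}
    (hV : IsFiniteUnionOfSaBoxes n d V) : ∃ P : OpSaSa n d X S, P.1 = V := by
  obtain ⟨𝓑, hfin, h𝓑, hV⟩ := hV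
  have := hfin.to_subtype
  exact ⟨⟨V, 𝓑, h𝓑, locallyFinite_of_finite _, hV⟩, rfl⟩

theorem mem_saSaTopology_of_isFiniteSup {P : OpSaSa n d X S} {R : Sieve P}
    (h : IsFiniteSup (fun V => ∃ (Q : OpSaSa n d X S) (f : Q ⟶ P), R f ∧ V ≤ Q.1) P.1) :
    R ∈ saSaTopology n d X S P := by
  obtain ⟨𝓕, hfin, h𝓕, hP⟩ := h
  have : Nonempty (OpSaSa n d X S) := ⟨P⟩
  choose! Q f hf hQ using h𝓕
  rw [← Sieve.generate_sieve R]
  refine Precoverage.generate_mem_toGrothendieck (J := { coverings := _ }) fun B _ hBP =>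
    ⟨Q '' 𝓕, ?_, hfin.image Q, fun p hp => ?_⟩
  · rintro _ ⟨V, hV, rfl⟩
    exact ⟨f V hV, hf V hV⟩
  · obtain ⟨V, hV, hpV⟩ := Opens.mem_sSup.1 (hP ▸ hBP hp : p ∈ sSup 𝓕)
    exact Set.mem_biUnion ⟨V, hV, rfl⟩ (hQ V hV hpV)

variable [T2Space S]

theorem WellInside.exists_opSaSa_between [IsManifold (𝓡 d) ω S] {V O : Opens (X × S)}
    (h : WellInside n V O) : ∃ P : OpSaSa n d X S,
      IsFiniteUnionOfSaBoxes n d P.1 ∧ WellInside n V P.1 ∧ WellInside n P.1 O := by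
  obtain ⟨_, hP, hVP, hPO⟩ := h.exists_between (d := d)
  obtain ⟨P, rfl⟩ := hP.exists_opSaSa_eq
  exact ⟨P, hP, hVP, hPO⟩

variable [T2Space X]

theorem WellInside.isFiniteUnionOfSaBoxes {P : OpSaSa n d X S} {O : Opens (X × S)}
    (h : WellInside n P.1 O) : IsFiniteUnionOfSaBoxes n d P.1 :=
  OpSaSa.isFiniteUnionOfSaBoxes_of_isCompact_closure h.isCompact_closure

variable (n d X S) in
/-- The objects of `X_sa × S_sa` that are well inside an open subset of `X × S`. -/
def wellInsideLowerSet : Opens (X × S) ⥤ LowerSet (OpSaSa n d X S) :=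
  Monotone.functor
    (f := fun O => ⟨{P | WellInside n P.1 O}, fun _ _ hQP hP => hP.mono_left
      (OpSaSa.isFiniteUnionOfSaBoxes_of_isCompact_closure
        (isCompact_closure_of_le hP.isCompact_closure hQP)).isFiniteSup hQP⟩)
    fun _ _ hO _ hP => hP.mono_right hO

theorem wellInsideLowerSet_obj_le (P : OpSaSa n d X S) :
    (wellInsideLowerSet n d X S).obj ((saSaInclusion n d X S).obj P) ≤ LowerSet.Iic P :=
  fun _ hQ => hQ.le

variable [IsManifold (𝓡 d) ω S]

theorem lowerSetSieve_iSup_wellInsideLowerSet_mem {U : OpSa n X S} {T : Sieve U}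
    (hT : T ∈ saTopology n X S U) {P : OpSaSa n d X S} (hP : WellInside n P.1 U.1) :
    lowerSetSieve (⨆ W : {W // ∃ f : W ⟶ U, T f}, (wellInsideLowerSet n d X S).obj W.1.1) P ∈
      saSaTopology n d X S P := by
  have : LocallyCompactSpace S := ChartedSpace.locallyCompactSpace (EuclideanSpace ℝ (Fin d)) S
  refine mem_saSaTopology_of_isFiniteSup <|
    (saTopology_le_wellInsideTopology n X S U hT P.1 hP).mono ?_
  rintro V hVP ⟨W, f, hf, hVW⟩
  obtain ⟨Q, hQ, hVQ, hQW⟩ := hVW.exists_opSaSa_between (d := d)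
  have hQP := hQ.inf hP.isFiniteUnionOfSaBoxes
  obtain ⟨Z, hZ⟩ := hQP.exists_opSaSa_eq
  have hZP : Z ≤ P := hZ.trans_le inf_le_right
  have hZW : WellInside n Z.1 W.1 := hZ ▸ hQW.mono_left hQP.isFiniteSup inf_le_left
  exact ⟨Z, homOfLE hZP, LowerSet.mem_iSup_iff.2 ⟨⟨W, f, hf⟩, hZW⟩,
    (le_inf hVQ.le hVP).trans_eq hZ.symm⟩

/-- The sheaf `O ↦ lim Γ(P; F)` on `X_sa × S`, where `P` runs through the objects of
`X_sa × S_sa` well inside `O`. It is a model of the inverse image of `F`. -/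
def interiorSheaf (F : Sheaf (saSaTopology n d X S) (ModuleCat.{u} ℂ)) :
    Sheaf (saTopology n X S) (ModuleCat.{u} ℂ) :=
  ⟨(saInclusion n X S).op ⋙ (wellInsideLowerSet n d X S).op ⋙ sectionsPresheaf F.obj,
    isSheaf_comp_sectionsPresheaf F (saInclusion n X S ⋙ wellInsideLowerSet n d X S)
      (fun _ _ _ hP hP' => WellInside.exists_opSa_le hP hP')
      fun _ _ hT _ hP => lowerSetSieve_iSup_wellInsideLowerSet_mem hT hP⟩

/-- The comparison between the presheaf whose associated sheaf is the inverse image and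
`interiorSheaf F`. -/
noncomputable def inverseImagePresheafToInterior
    (F : Sheaf (saSaTopology n d X S) (ModuleCat.{u} ℂ)) :
    inverseImagePresheaf F ⟶ (interiorSheaf F).obj :=
  Functor.whiskerLeft (saInclusion n X S).op (lanToSections F.obj wellInsideLowerSet_obj_le)

variable [IsManifold (𝓡 n) ω X] (F : Sheaf (saSaTopology n d X S) (ModuleCat.{u} ℂ))

instance : Presheaf.IsLocallySurjective (saTopology n X S) (inverseImagePresheafToInterior F) where
  imageSieve_mem {U} s := by
    have : LocallyCompactSpace S := ChartedSpace.locallyCompactSpace (EuclideanSpace ℝ (Fin d)) S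
    refine GrothendieckTopology.superset_covering _ ?_ (wellInsideSieve_mem_saTopology U)
    intro W f (hW : WellInside n W.1 U.1)
    obtain ⟨P, -, hWP, hPU⟩ := hW.exists_opSaSa_between (d := d)
    exact exists_lanToSections_eq wellInsideLowerSet_obj_le s hPU hWP.le hW.le

instance : Presheaf.IsLocallyInjective (saTopology n X S) (inverseImagePresheafToInterior F) where
  equalizerSieve_mem {U} x y hxy := by
    have : LocallyCompactSpace S := ChartedSpace.locallyCompactSpace (EuclideanSpace ℝ (Fin d)) S
    have : (saSaInclusion n d X S).Full := ⟨fun f => ⟨homOfLE (leOfHom f), rfl⟩⟩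
    have : (saSaInclusion n d X S).Faithful := ⟨fun _ => Subsingleton.elim _ _⟩
    refine GrothendieckTopology.superset_covering _ ?_ (wellInsideSieve_mem_saTopology U.unop)
    intro W f (hW : WellInside n W.1 U.unop.1)
    obtain ⟨P, -, hWP, hPU⟩ := hW.exists_opSaSa_between (d := d)
    obtain ⟨Q, -, hWQ, hQP⟩ := hWP.exists_opSaSa_between (d := d)
    exact presheafRes_eq_of_lanToSections_eq wellInsideLowerSet_obj_le hxy hPU.le hQP hWQ.le hW.le

/-- The inverse image of `F` is `interiorSheaf F`: the comparison map of presheaves is locally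
bijective, hence becomes an isomorphism after sheafification. -/
noncomputable def inverseImageIsoInteriorSheaf : inverseImage F ≅ interiorSheaf F :=
  have h := ((saTopology n X S).W_iff _).1
    ((saTopology n X S).W_of_isLocallyBijective (inverseImagePresheafToInterior F))
  @asIso _ _ _ _ _ h ≪≫ asIso ((sheafificationAdjunction _ _).counit.app (interiorSheaf F))

variable {F} [SecondCountableTopology X] [SecondCountableTopology S]

theorem IsTFlabby.isCSoft_interiorSheaf (hF : IsTFlabby F) : IsCSoft (interiorSheaf F) := by
  have : LocallyCompactSpace S := ChartedSpace.locallyCompactSpace (EuclideanSpace ℝ (Fin d)) S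
  refine isCSoft_of_forall_exists fun V U W hVU hVW s => ?_
  obtain ⟨P, hP, hVP, hPUW⟩ :=
    (hVU.wellInside.le_inf hVW.wellInside).exists_opSaSa_between (d := d)
  have hPU : WellInside n P.1 U.1 := hPUW.mono_right inf_le_left
  let P₀ : OpSa n X S := ⟨P.1, hP.isFiniteSup⟩
  let I := wellInsideLowerSet n d X S
  let s' : sectionsOn F.obj (I.obj U.1) := s
  obtain ⟨f, hf⟩ := hF P hP (s'.1 ⟨P, hPU⟩)
  let t : sectionsOn F.obj (I.obj W.1) := resSections F.obj (I.monotone (le_top (a := W.1)))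
    (((toSectionsOn F.obj wellInsideLowerSet_obj_le).app (op (saSaTop n d X S))).hom f)
  refine ⟨P₀, hPUW.le.trans inf_le_left, hPUW.le.trans inf_le_right, t,
    WellInside.isWeaklyQuasiCompactIn hVP, sectionsOn_ext fun Q => ?_⟩
  have hQP : Q.1 ≤ P := WellInside.le Q.2
  have hP_top : P ≤ saSaTop n d X S := le_top (a := P.1)
  calc presheafRes F.obj (hQP.trans hP_top) f
      = presheafRes F.obj hQP (presheafRes F.obj hP_top f) :=
        (presheafRes_presheafRes F.obj hQP hP_top f).symm
    _ = presheafRes F.obj hQP (s'.1 ⟨P, hPU⟩) := congrArg _ hf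
    _ = s'.1 ⟨Q.1, WellInside.mono_right Q.2 hPU.le⟩ :=
        s'.2 ⟨Q.1, WellInside.mono_right Q.2 hPU.le⟩ ⟨P, hPU⟩ hQP

end InverseImage

theorem mainTheorem8 (n d : ℕ) (X S : Type u) [TopologicalSpace X] [TopologicalSpace S]
    [T2Space X] [T2Space S] [SecondCountableTopology X] [SecondCountableTopology S]
    [ChartedSpace (EuclideanSpace ℝ (Fin n)) X] [ChartedSpace (EuclideanSpace ℝ (Fin d)) S]
    [IsManifold (𝓡 n) ω X] [IsManifold (𝓡 d) ω S]
    (F : Sheaf (saSaTopology n d X S) (ModuleCat.{u} ℂ)) (hF : IsTFlabby F) :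
    IsCSoft (inverseImage F) :=
  hF.isCSoft_interiorSheaf.of_iso (inverseImageIsoInteriorSheaf F).symm
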